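/- Let $\rho$ be a Lévy measure on $(0,\infty)$, i.e. a Borel measure with $\int_{(0,1]}x^2\,\rho(dx)<\infty$ and $\rho((1,\infty))<\infty$, and suppose that $\int_{(0,1]}x\,\rho(dx)<\infty$. On a probability space $(\Omega,\mathcal F,P)$, let $N^*=\sum_{i}\delta_{U_i}$ be a Poisson process on $(0,\infty)$ with intensity $\rho$: a random measure with values in $\{0,1,2,\dots\}$ on Borel sets bounded away from $0$ and $\infty$, such that, for every Borel set $B\subseteq(0,\infty)$, $N^*(B)$ has the Poisson distribution with mean $\rho(B)$ (and $N^*(B)=\infty$ almost surely if $\rho(B)=\infty$), and such that $N^*(B_1),\dots,N^*(B_n)$ are independent whenever $B_1,\dots,B_n$ are pairwise disjoint Borel sets. Here $(U_i)$ enumerates the points of $N^*$, repeated according to multiplicity; their number is random and may be finite or infinite. Then the random variable $X:=\sum_i U_i$ is finite almost surely and its distribution is infinitely divisible (for every $n\ge1$, $X$ has the same distribution as a sum of $n$ independent identically distributed real random variables). Moreover, for every $u\in\mathbb R$, the function $x\mapsto e^{iux}-1$ is $\rho$-integrable and $$E\bigl(e^{iuX}\bigr)=\exp\left\{\int_0^\infty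 (e^{iux}-1)\,\rho(dx)\right\}.$$ -/

import Mathlib

open MeasureTheory ProbabilityTheory
open scoped ENNReal NNReal

noncomputable section

/-- The elements of `M_p(E)`: measures on `E` which take a (finite) value in `{0, 1, 2, …}` on
every Borel set contained in a compact set. For `E = (0,∞)` these Borel sets are the ones which
are bounded away from `0` and from `∞`. -/
def IsPointMeasure {E : Type*} [TopologicalSpace E] [MeasurableSpace E] (μ : Measure E) : Prop :=
  ∀ B : Set E, MeasurableSet B → (∃ C : Set E, IsCompact C ∧ B ⊆ C) → ∃ n : ℕ, μ B = n

/-- A point process on `E`: a random element of `M_p(E)`. The `σ`-algebra on the space of measures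
is generated by the evaluations `μ ↦ μ B` at the measurable sets `B`. -/
structure IsPointProcess {Ω E : Type*} [MeasurableSpace Ω] [TopologicalSpace E]
    [MeasurableSpace E] (N : Ω → Measure E) : Prop where
  measurable : Measurable N
  isPointMeasure : ∀ ω, IsPointMeasure (N ω)

/-- `N` is a Poisson process on `E` with intensity `ρ`, under the probability `P`:
a point process such that `N(B)` has the Poisson distribution with mean `ρ(B)` (the unit mass
at `∞` if `ρ(B) = ∞`), and such that `N(B₁), …, N(Bₙ)` are independent whenever `B₁, …, Bₙ` are
pairwise disjoint. -/
structure IsPoissonProcess {Ω E : Type*} [MeasurableSpace Ω] [TopologicalSpace E]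
    [MeasurableSpace E] (N : Ω → Measure E) (ρ : Measure E) (P : Measure Ω) : Prop where
  isPointProcess : IsPointProcess N
  hasLaw_poisson : ∀ B : Set E, MeasurableSet B → ρ B ≠ ∞ →
    HasLaw (fun ω => N ω B)
      ((poissonMeasure (ρ B).toNNReal).map (fun n : ℕ => (n : ℝ≥0∞))) P
  eq_top : ∀ B : Set E, MeasurableSet B → ρ B = ∞ → ∀ᵐ ω ∂P, N ω B = ∞
  indep : ∀ (n : ℕ) (B : Fin n → Set E), (∀ i, MeasurableSet (B i)) →
    Pairwise (fun i j => Disjoint (B i) (B j)) → iIndepFun (fun i ω => N ω (B i)) P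

/-- A Lévy measure on `(0,∞)`: `∫_{(0,1]} x² ρ(dx) < ∞` and `ρ((1,∞)) < ∞`. -/
structure IsLevyMeasure (ρ : Measure (Set.Ioi (0 : ℝ))) : Prop where
  lintegral_sq_lt_top :
    ∫⁻ x in {x : Set.Ioi (0 : ℝ) | (x : ℝ) ≤ 1}, ENNReal.ofReal ((x : ℝ) ^ 2) ∂ρ < ∞
  tail_lt_top : ρ {x : Set.Ioi (0 : ℝ) | 1 < (x : ℝ)} < ∞

/-- The law `μ` on `ℝ` is infinitely divisible: for every `n ≥ 1` it is the law of the sum of `n`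
independent random variables with a common distribution `ν`. -/
def IsInfinitelyDivisible (μ : Measure ℝ) : Prop :=
  ∀ n : ℕ, 1 ≤ n → ∃ ν : Measure ℝ, IsProbabilityMeasure ν ∧
    μ = (Measure.pi (fun _ : Fin n => ν)).map (fun x => ∑ i, x i)

/-- The measure `∑_{i < k} δ_{u i}`, where the number `k ∈ {0, 1, 2, …, ∞}` of points may be
infinite. -/
def sumDirac {E : Type*} [MeasurableSpace E] (k : ℕ∞) (u : ℕ → E) : Measure E :=
  Measure.sum (fun i : {i : ℕ // (i : ℕ∞) < k} => Measure.dirac (u i))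

/-- The sum `∑_{i < k} u i ∈ [0,∞]` of the points. -/
def sumPoints (k : ℕ∞) (u : ℕ → Set.Ioi (0 : ℝ)) : ℝ≥0∞ :=
  ∑' i : {i : ℕ // (i : ℕ∞) < k}, ENNReal.ofReal (u i : ℝ)

end

open Filter Topology

/-! `X` is the integral of the function `f x = x` against `N`. For a finite-valued simple `f` whose
nonzero level sets have finite `ρ`-measure, that integral is a combination of independent Poisson
variables, and its characteristic function is `exp (levyExponent ρ f t)`. If `∫ min(f, 1) dρ < ∞`,
approximate `f` from below by simple functions: the exponents converge by dominated convergence to a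
limit continuous at `0`, so the laws of the approximating integrals are tight. An increasing
sequence with tight laws stays finite in the limit almost surely
(`IsPoissonProcess.ae_lintegral_lt_top`), and the characteristic functions pass to the limit
(`IsPoissonProcess.charFun_lintegral`).

Infinite divisibility is read off the exponent: dividing `ρ` by `n` gives an `n`-th root, which the
same approximation shows to be a characteristic function (`exists_charFun_eq_exp_levyExponent`).
This needs only laws, not a Poisson process of intensity `ρ / n`. -/

/-- The integral of `exp (i t f) - 1` against `ρ`. -/
noncomputable def levyExponent {E : Type*} [MeasurableSpace E] (ρ : Measure E) (f : E → ℝ≥0∞)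
    (t : ℝ) : ℂ :=
  ∫ x, (Complex.exp (t * (f x).toReal * Complex.I) - 1) ∂ρ

/-- A pointwise limit of characteristic functions which is continuous at `0` is a characteristic
function. -/
lemma exists_charFun_eq_of_tendsto {μ : ℕ → Measure ℝ} [∀ i, IsProbabilityMeasure (μ i)]
    {f : ℝ → ℂ} (hf : ContinuousAt f 0)
    (h : ∀ t, Tendsto (fun n ↦ charFun (μ n) t) atTop (𝓝 (f t))) :
    ∃ ν : Measure ℝ, IsProbabilityMeasure ν ∧ charFun ν = f := by
  -- Continuity at `0` prevents mass from escaping; Prokhorov then yields a weakly convergent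
  -- subsequence.
  have htight := isTightMeasureSet_of_tendsto_charFun hf h
  let p : ℕ → ProbabilityMeasure ℝ := fun n ↦ ⟨μ n, inferInstance⟩
  have hc : IsCompact (closure (Set.range p)) := by
    apply isCompact_closure_of_isTightMeasureSet
    convert htight using 1
    ext m
    exact ⟨fun ⟨_, ⟨n, hn⟩, h⟩ ↦ ⟨n, by rw [← h, ← hn]; rfl⟩,
      fun ⟨n, hn⟩ ↦ ⟨p n, ⟨n, rfl⟩, hn⟩⟩
  obtain ⟨ν, -, φ, hφ, hlim⟩ := hc.tendsto_subseq (x := p)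
    (fun n ↦ subset_closure (Set.mem_range_self n))
  refine ⟨ν, inferInstance, funext fun t ↦ ?_⟩
  have h1 := ProbabilityMeasure.tendsto_iff_tendsto_charFun.1 hlim t
  exact tendsto_nhds_unique h1 ((h t).comp hφ.tendsto_atTop)

/-- Convolve one Poisson law of mean `r a`, scaled by `a`, for each `a ∈ s`. -/
lemma exists_charFun_eq_exp_sum (s : Finset ℝ≥0∞) (r : ℝ≥0∞ → ℝ≥0) :
    ∃ ν : Measure ℝ, IsProbabilityMeasure ν ∧ ∀ t : ℝ, charFun ν t =
      Complex.exp (∑ a ∈ s, r a * (Complex.exp (t * a.toReal * Complex.I) - 1)) := by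
  classical
  induction s using Finset.induction_on with
  | empty => exact ⟨Measure.dirac 0, inferInstance, by simp⟩
  | insert a s ha ih =>
    obtain ⟨ν, hν, h⟩ := ih
    let q : Measure ℝ := ((poissonMeasure (r a)).map (fun n : ℕ ↦ (n : ℝ))).map (a.toReal * ·)
    have : IsProbabilityMeasure ((poissonMeasure (r a)).map (fun n : ℕ ↦ (n : ℝ))) :=
      Measure.isProbabilityMeasure_map (by fun_prop)
    have hq : IsProbabilityMeasure q := Measure.isProbabilityMeasure_map (by fun_prop)
    refine ⟨q.conv ν, inferInstance, fun t ↦ ?_⟩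
    rw [charFun_conv, h, Finset.sum_insert ha, Complex.exp_add, charFun_map_mul,
      charFun_map_cast_poissonMeasure]
    push_cast
    ring_nf

/-! ### The exponent and its approximation by simple functions -/

section

variable {E : Type*} [MeasurableSpace E] {ρ : Measure E} {f : E → ℝ≥0∞}

/-- This bound is why `∫ min(f, 1) dρ < ∞` is the right hypothesis: it supplies every dominating
function for the exponent. -/
lemma norm_exp_mul_sub_one_le (t : ℝ) (a : ℝ≥0∞) :
    ‖Complex.exp (t * a.toReal * Complex.I) - 1‖ ≤ (2 + |t|) * (min a 1).toReal := by
  have h1 : ‖Complex.exp (t * a.toReal * Complex.I) - 1‖ ≤ |t| * a.toReal := by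
    have := Real.norm_exp_I_mul_ofReal_sub_one_le (x := t * a.toReal)
    rw [mul_comm] at this
    push_cast at this
    simpa [abs_mul] using this
  have h2 : ‖Complex.exp (t * a.toReal * Complex.I) - 1‖ ≤ 2 := by
    refine (norm_sub_le _ _).trans ?_
    rw [← Complex.ofReal_mul, Complex.norm_exp_ofReal_mul_I]
    norm_num
  rcases le_total a 1 with h | h
  · rw [min_eq_left h]
    nlinarith [ENNReal.toReal_nonneg (a := a), abs_nonneg t]
  · rw [min_eq_right h]
    simp only [ENNReal.toReal_one]
    nlinarith [abs_nonneg t]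

lemma integrable_toReal_min (hf : Measurable f) (hρ : ∫⁻ x, min (f x) 1 ∂ρ < ∞) :
    Integrable (fun x ↦ (min (f x) 1).toReal) ρ :=
  integrable_toReal_of_lintegral_ne_top (hf.min measurable_const).aemeasurable hρ.ne

lemma measurable_exp_mul_sub_one (hf : Measurable f) (t : ℝ) :
    Measurable (fun x ↦ Complex.exp (t * (f x).toReal * Complex.I) - 1) := by
  have := hf.ennreal_toReal
  fun_prop

lemma integrable_exp_mul_sub_one (hf : Measurable f)
    (hρ : ∫⁻ x, min (f x) 1 ∂ρ < ∞) (t : ℝ) :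
    Integrable (fun x ↦ Complex.exp (t * (f x).toReal * Complex.I) - 1) ρ :=
  ((integrable_toReal_min hf hρ).const_mul (2 + |t|)).mono'
    (measurable_exp_mul_sub_one hf t).aestronglyMeasurable
    (.of_forall fun x ↦ norm_exp_mul_sub_one_le t (f x))

lemma continuousAt_levyExponent (hf : Measurable f)
    (hρ : ∫⁻ x, min (f x) 1 ∂ρ < ∞) : ContinuousAt (levyExponent ρ f) 0 := by
  refine continuousAt_of_dominated (bound := fun x ↦ (2 + 1) * (min (f x) 1).toReal)
    (.of_forall fun t ↦ (measurable_exp_mul_sub_one hf t).aestronglyMeasurable) ?_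
    ((integrable_toReal_min hf hρ).const_mul _) (.of_forall fun x ↦ by fun_prop)
  have : ∀ᶠ t : ℝ in 𝓝 0, |t| < 1 := by
    have h : Tendsto (fun t : ℝ ↦ |t|) (𝓝 0) (𝓝 |0|) := continuous_abs.tendsto 0
    exact h.eventually_lt_const (by simp)
  filter_upwards [this] with t ht
  refine .of_forall fun x ↦ (norm_exp_mul_sub_one_le t (f x)).trans ?_
  gcongr

lemma tendsto_levyExponent_eapprox (hf : Measurable f) (hfin : ∀ x, f x < ∞)
    (hρ : ∫⁻ x, min (f x) 1 ∂ρ < ∞) (t : ℝ) :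
    Tendsto (fun n ↦ levyExponent ρ (SimpleFunc.eapprox f n) t) atTop
      (𝓝 (levyExponent ρ f t)) := by
  refine tendsto_integral_of_dominated_convergence
    (fun x ↦ (2 + |t|) * (min (f x) 1).toReal)
    (fun n ↦ (measurable_exp_mul_sub_one (SimpleFunc.measurable _) t).aestronglyMeasurable)
    ((integrable_toReal_min hf hρ).const_mul _) (fun n ↦ .of_forall fun x ↦ ?_)
    (.of_forall fun x ↦ ?_)
  · refine (norm_exp_mul_sub_one_le t _).trans ?_
    have hle : SimpleFunc.eapprox f n x ≤ f x := by
      rw [← SimpleFunc.iSup_eapprox_apply hf x]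
      exact le_iSup (fun n ↦ SimpleFunc.eapprox f n x) n
    gcongr
    · simp
  · have h := (ENNReal.tendsto_toReal (hfin x).ne).comp (SimpleFunc.tendsto_eapprox hf x)
    have hc : Continuous fun y : ℝ ↦ Complex.exp (t * y * Complex.I) - 1 := by fun_prop
    exact (hc.tendsto _).comp h

lemma lintegral_eq_iSup_eapprox (hf : Measurable f) (μ : Measure E) :
    ∫⁻ x, f x ∂μ = ⨆ n, ∫⁻ x, SimpleFunc.eapprox f n x ∂μ := by
  rw [← lintegral_iSup (fun n ↦ SimpleFunc.measurable _)
    (fun _ _ h ↦ SimpleFunc.monotone_eapprox f h)]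
  simp_rw [SimpleFunc.iSup_eapprox_apply hf]

/-- Markov's inequality: on this level set `min(f, 1) ≥ min(a, 1) > 0`, because the approximation
lies below `f`. -/
lemma measure_preimage_eapprox_lt_top (hf : Measurable f) (hρ : ∫⁻ x, min (f x) 1 ∂ρ < ∞)
    (n : ℕ) {a : ℝ≥0∞} (ha : a ≠ 0) : ρ (SimpleFunc.eapprox f n ⁻¹' {a}) < ∞ := by
  have hm : min a 1 ≠ 0 := by simp [ha]
  refine (measure_mono fun x hx ↦ ?_).trans_lt
    ((meas_ge_le_lintegral_div (hf.min measurable_const).aemeasurable hm (by simp)).trans_lt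
      (ENNReal.div_lt_top hρ.ne hm))
  have hle : SimpleFunc.eapprox f n x ≤ f x := by
    rw [← SimpleFunc.iSup_eapprox_apply hf x]
    exact le_iSup (fun n ↦ SimpleFunc.eapprox f n x) n
  rw [Set.mem_preimage, Set.mem_singleton_iff] at hx
  exact min_le_min_right 1 (hx ▸ hle)

/-- The value `0` is left out because its level set may have infinite measure; the integrand
vanishes there. -/
lemma levyExponent_simpleFunc (g : SimpleFunc E ℝ≥0∞)
    (hg : ∀ a, a ≠ 0 → ρ (g ⁻¹' {a}) < ∞) (t : ℝ) :
    levyExponent ρ g t = ∑ a ∈ g.range with a ≠ 0,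
      (ρ (g ⁻¹' {a})).toNNReal * (Complex.exp (t * a.toReal * Complex.I) - 1) := by
  classical
  have hpt (x : E) : Complex.exp (t * (g x).toReal * Complex.I) - 1 =
      ∑ a ∈ g.range with a ≠ 0, (g ⁻¹' {a}).indicator
        (fun _ ↦ Complex.exp (t * a.toReal * Complex.I) - 1) x := by
    simp only [Set.indicator_apply, Set.mem_preimage, Set.mem_singleton_iff, Finset.sum_ite_eq,
      Finset.mem_filter, SimpleFunc.mem_range_self, true_and]
    split_ifs with h
    · rfl
    · simp [not_not.1 h]
  rw [levyExponent]
  simp_rw [hpt]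
  rw [integral_finsetSum]
  · refine Finset.sum_congr rfl fun a _ ↦ ?_
    rw [integral_indicator_const _ (g.measurableSet_preimage _)]
    simp [Measure.real, ENNReal.coe_toNNReal_eq_toReal]
  · intro a ha
    exact (integrable_indicator_iff (g.measurableSet_preimage _)).2
      (integrableOn_const (hg a (Finset.mem_filter.1 ha).2).ne)

/-- The function `exp (∫ (exp (i t f) - 1) dρ)` is a characteristic function. -/
lemma exists_charFun_eq_exp_levyExponent (hf : Measurable f) (hfin : ∀ x, f x < ∞)
    (hρ : ∫⁻ x, min (f x) 1 ∂ρ < ∞) :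
    ∃ ν : Measure ℝ, IsProbabilityMeasure ν ∧
      charFun ν = fun t ↦ Complex.exp (levyExponent ρ f t) := by
  have h (n : ℕ) : ∃ ν : Measure ℝ, IsProbabilityMeasure ν ∧ ∀ t : ℝ, charFun ν t =
      Complex.exp (levyExponent ρ (SimpleFunc.eapprox f n) t) := by
    obtain ⟨ν, hν, h⟩ := exists_charFun_eq_exp_sum
      {a ∈ (SimpleFunc.eapprox f n).range | a ≠ 0}
      (fun a ↦ (ρ (SimpleFunc.eapprox f n ⁻¹' {a})).toNNReal)
    refine ⟨ν, hν, fun t ↦ ?_⟩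
    rw [h, levyExponent_simpleFunc _ fun a ha ↦ measure_preimage_eapprox_lt_top hf hρ n ha]
  choose μ hμ hc using h
  refine exists_charFun_eq_of_tendsto (μ := μ)
    (continuousAt_levyExponent hf hρ).cexp fun t ↦ ?_
  simp_rw [hc]
  exact (tendsto_levyExponent_eapprox hf hfin hρ t).cexp

/-- A law with characteristic function `exp (∫ (exp (i t f) - 1) dρ)` is infinitely divisible. -/
lemma isInfinitelyDivisible_of_charFun_eq (hf : Measurable f) (hfin : ∀ x, f x < ∞)
    (hρ : ∫⁻ x, min (f x) 1 ∂ρ < ∞) {μ : Measure ℝ} [IsProbabilityMeasure μ]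
    (hμ : charFun μ = fun t ↦ Complex.exp (levyExponent ρ f t)) :
    IsInfinitelyDivisible μ := by
  intro n hn
  have hn0 : (n : ℂ) ≠ 0 := by exact_mod_cast (by omega : n ≠ 0)
  -- The exponent is linear in the intensity, so the intensity `ρ / n` yields the `n`-th convolution
  -- root.
  have hρ' : ∫⁻ x, min (f x) 1 ∂((n : ℝ≥0∞)⁻¹ • ρ) < ∞ := by
    rw [lintegral_smul_measure]
    exact ENNReal.mul_lt_top (by simp; omega) hρ
  obtain ⟨ν, hν, hc⟩ := exists_charFun_eq_exp_levyExponent hf hfin hρ'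
  refine ⟨ν, hν, ?_⟩
  have : IsProbabilityMeasure ((Measure.pi fun _ : Fin n ↦ ν).map fun x ↦ ∑ i, x i) :=
    Measure.isProbabilityMeasure_map (by fun_prop)
  refine Measure.ext_of_charFun ?_
  rw [charFun_map_sum_pi_eq_prod, hμ, hc]
  ext t
  simp only [Finset.prod_const, Finset.card_univ, Fintype.card_fin, Pi.pow_apply]
  rw [← Complex.exp_nat_mul, levyExponent, levyExponent, integral_smul_measure]
  congr 1
  simp [hn0]

end

/-! ### Integrals against a Poisson process -/

section

variable {Ω E : Type*} [MeasurableSpace Ω] [TopologicalSpace E] [MeasurableSpace E]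
  {P : Measure Ω} {ρ : Measure E} {N : Ω → Measure E} {f : E → ℝ≥0∞}

lemma IsPoissonProcess.measurable_eval (hN : IsPoissonProcess N ρ P) {B : Set E}
    (hB : MeasurableSet B) : Measurable fun ω ↦ N ω B :=
  (Measure.measurable_coe hB).comp hN.isPointProcess.measurable

lemma IsPoissonProcess.measurable_lintegral (hN : IsPoissonProcess N ρ P) (hf : Measurable f) :
    Measurable fun ω ↦ ∫⁻ x, f x ∂N ω :=
  (Measure.measurable_lintegral hf).comp hN.isPointProcess.measurable

lemma IsPoissonProcess.charFun_const_mul (hN : IsPoissonProcess N ρ P) {B : Set E}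
    (hB : MeasurableSet B) (hρB : ρ B ≠ ∞) (c t : ℝ) :
    charFun (P.map fun ω ↦ c * (N ω B).toReal) t =
      Complex.exp ((ρ B).toNNReal * (Complex.exp (t * c * Complex.I) - 1)) := by
  have hm : P.map (fun ω ↦ (N ω B).toReal) =
      (poissonMeasure (ρ B).toNNReal).map (fun n : ℕ ↦ (n : ℝ)) := by
    rw [← Function.comp_def ENNReal.toReal (fun ω ↦ N ω B),
      ← Measure.map_map ENNReal.measurable_toReal (hN.measurable_eval hB),
      (hN.hasLaw_poisson B hB hρB).map_eq,
      Measure.map_map ENNReal.measurable_toReal (by fun_prop)]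
    rfl
  rw [charFun_map_mul_comp (hN.measurable_eval hB).ennreal_toReal.aemeasurable, hm,
    charFun_map_cast_poissonMeasure]
  push_cast
  ring_nf

lemma IsPoissonProcess.ae_lt_top (hN : IsPoissonProcess N ρ P) {B : Set E}
    (hB : MeasurableSet B) (hρB : ρ B ≠ ∞) : ∀ᵐ ω ∂P, N ω B < ∞ := by
  have h : ∀ᵐ y ∂((poissonMeasure (ρ B).toNNReal).map (fun n : ℕ ↦ (n : ℝ≥0∞))), y < ∞ := by
    rw [ae_map_iff (by fun_prop) measurableSet_Iio]
    simp
  rw [← (hN.hasLaw_poisson B hB hρB).map_eq] at h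
  exact ae_of_ae_map (hN.measurable_eval hB).aemeasurable h

/-- Level sets are disjoint, so their counts are independent and the characteristic function factors
into scaled Poisson ones. -/
lemma IsPoissonProcess.charFun_lintegral_simpleFunc (hN : IsPoissonProcess N ρ P)
    (g : SimpleFunc E ℝ≥0∞) (hfin : ∀ x, g x < ∞) (hg : ∀ a, a ≠ 0 → ρ (g ⁻¹' {a}) < ∞) (t : ℝ) :
    charFun (P.map fun ω ↦ (∫⁻ x, g x ∂N ω).toReal) t = Complex.exp (levyExponent ρ g t) := by
  classical
  let s : Finset ℝ≥0∞ := {a ∈ g.range | a ≠ 0}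
  have hmeas (a : ℝ≥0∞) : MeasurableSet (g ⁻¹' {a}) := g.measurableSet_preimage _
  have hs (a : s) : ρ (g ⁻¹' {(a : ℝ≥0∞)}) ≠ ∞ := (hg a (Finset.mem_filter.1 a.2).2).ne
  have hae : (fun ω ↦ (∫⁻ x, g x ∂N ω).toReal) =ᵐ[P]
      fun ω ↦ ∑ a : s, (a : ℝ≥0∞).toReal * (N ω (g ⁻¹' {(a : ℝ≥0∞)})).toReal := by
    have h : ∀ᵐ ω ∂P, ∀ a : s, N ω (g ⁻¹' {(a : ℝ≥0∞)}) < ∞ :=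
      ae_all_iff.2 fun a ↦ hN.ae_lt_top (hmeas _) (hs a)
    filter_upwards [h] with ω hω
    have h1 : ∫⁻ x, g x ∂N ω = ∑ a : s, (a : ℝ≥0∞) * N ω (g ⁻¹' {(a : ℝ≥0∞)}) := by
      rw [SimpleFunc.lintegral_eq_lintegral, SimpleFunc.lintegral,
        Finset.sum_coe_sort s (fun a ↦ a * N ω (g ⁻¹' {a})), Finset.sum_filter]
      refine Finset.sum_congr rfl fun a _ ↦ ?_
      split_ifs with h
      · rfl
      · simp [not_not.1 h]
    rw [h1, ENNReal.toReal_sum]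
    · simp [ENNReal.toReal_mul]
    · intro a _
      obtain ⟨x, hx⟩ := SimpleFunc.mem_range.1 (Finset.mem_filter.1 a.2).1
      exact ENNReal.mul_ne_top (hx ▸ (hfin x).ne) (hω a).ne
  have hind : iIndepFun (fun (a : s) ω ↦ N ω (g ⁻¹' {(a : ℝ≥0∞)})) P := by
    have h := hN.indep (Fintype.card s)
      (fun i ↦ g ⁻¹' {(((Fintype.equivFin s).symm i : s) : ℝ≥0∞)}) (fun i ↦ hmeas _) ?_
    · have h2 := h.precomp (Fintype.equivFin s).injective
      simpa [Function.comp_def] using h2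
    · intro i j hij
      refine Disjoint.preimage _ (Set.disjoint_singleton.2 ?_)
      exact fun h ↦ hij ((Fintype.equivFin s).symm.injective (Subtype.ext h))
  have hind' := hind.comp (fun a y ↦ (a : ℝ≥0∞).toReal * y.toReal)
    (fun a ↦ ENNReal.measurable_toReal.const_mul _)
  rw [Measure.map_congr hae]
  have hprod := iIndepFun.charFun_map_fun_sum_eq_prod (fun a : s ↦
    ((hN.measurable_eval (hmeas a)).ennreal_toReal.const_mul (a : ℝ≥0∞).toReal).aemeasurable) hind'
  rw [hprod, Finset.prod_apply, levyExponent_simpleFunc g hg, ← Finset.sum_coe_sort,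
    Complex.exp_sum]
  exact Finset.prod_congr rfl fun a _ ↦ hN.charFun_const_mul (hmeas _) (hs a) _ t

lemma IsPoissonProcess.tendsto_charFun_lintegral_eapprox [IsProbabilityMeasure P] (hN : IsPoissonProcess N ρ P)
    (hf : Measurable f) (hfin : ∀ x, f x < ∞) (hρ : ∫⁻ x, min (f x) 1 ∂ρ < ∞) (t : ℝ) :
    Tendsto (fun n ↦ charFun (P.map fun ω ↦ (∫⁻ x, SimpleFunc.eapprox f n x ∂N ω).toReal) t)
      atTop (𝓝 (Complex.exp (levyExponent ρ f t))) := by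
  simp_rw [fun n ↦ hN.charFun_lintegral_simpleFunc (SimpleFunc.eapprox f n)
    (SimpleFunc.eapprox_lt_top f n) (fun a ha ↦ measure_preimage_eapprox_lt_top hf hρ n ha) t]
  exact (tendsto_levyExponent_eapprox hf hfin hρ t).cexp

/-- The integral of `f` against a Poisson process with intensity `ρ` is almost surely finite if
`∫ min(f, 1) dρ < ∞`. -/
theorem IsPoissonProcess.ae_lintegral_lt_top [IsProbabilityMeasure P] (hN : IsPoissonProcess N ρ P)
    (hf : Measurable f) (hfin : ∀ x, f x < ∞) (hρ : ∫⁻ x, min (f x) 1 ∂ρ < ∞) :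
    ∀ᵐ ω ∂P, ∫⁻ x, f x ∂N ω < ∞ := by
  let Y (n : ℕ) (ω : Ω) : ℝ≥0∞ := ∫⁻ x, SimpleFunc.eapprox f n x ∂N ω
  have hYm (n : ℕ) : Measurable (Y n) := hN.measurable_lintegral (SimpleFunc.measurable _)
  -- Needed because `toReal` sends `∞` to `0`: otherwise the tails of `(Y n).toReal` would not
  -- control those of `Y n`.
  have hYfin : ∀ᵐ ω ∂P, ∀ n, Y n ω < ∞ := by
    refine ae_all_iff.2 fun n ↦ ?_
    have h : ∀ᵐ ω ∂P, ∀ a ∈ (SimpleFunc.eapprox f n).range, a ≠ 0 →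
        N ω (SimpleFunc.eapprox f n ⁻¹' {a}) < ∞ := by
      refine (Finset.eventually_all _).2 fun a _ ↦ ?_
      by_cases ha : a = 0
      · simp [ha]
      · filter_upwards [hN.ae_lt_top (SimpleFunc.measurableSet_preimage _ _)
          (measure_preimage_eapprox_lt_top hf hρ n ha).ne] with ω hω _ using hω
    filter_upwards [h] with ω hω
    simp only [Y]
    rw [SimpleFunc.lintegral_eq_lintegral, SimpleFunc.lintegral]
    refine ENNReal.sum_lt_top.2 fun a ha ↦ ?_
    by_cases ha0 : a = 0
    · simp [ha0]
    · obtain ⟨x, hx⟩ := SimpleFunc.mem_range.1 ha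
      exact ENNReal.mul_lt_top (hx ▸ SimpleFunc.eapprox_lt_top f n x) (hω a ha ha0)
  have (n : ℕ) : IsProbabilityMeasure (P.map fun ω ↦ (Y n ω).toReal) :=
    Measure.isProbabilityMeasure_map (hYm n).ennreal_toReal.aemeasurable
  have htight := isTightMeasureSet_of_tendsto_charFun
    (continuousAt_levyExponent hf hρ).cexp
    (hN.tendsto_charFun_lintegral_eapprox hf hfin hρ)
  rw [isTightMeasureSet_iff_exists_isCompact_measure_compl_le] at htight
  -- Tightness gives one `M` with `P(Y n > M) ≤ ε` for all `n`. These events increase with `n` and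
  -- their union contains the event that the integral is infinite.
  have hzero : P {ω | ∫⁻ x, f x ∂N ω = ∞} = 0 := by
    refine le_antisymm (ENNReal.le_of_forall_pos_le_add fun ε hε _ ↦ ?_) bot_le
    obtain ⟨C, hC, hle⟩ := htight ε (by exact_mod_cast hε)
    obtain ⟨M, hM⟩ := hC.isBounded.exists_norm_le
    have hbound (n : ℕ) : P {ω | ENNReal.ofReal M < Y n ω} ≤ ε := by
      refine le_trans ?_ (hle _ ⟨n, rfl⟩)
      rw [Measure.map_apply (hYm n).ennreal_toReal hC.measurableSet.compl]
      refine measure_mono_ae ?_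
      filter_upwards [hYfin] with ω hω hlt hmem
      have h1 := (le_abs_self _).trans (hM _ (by simpa using hmem))
      exact absurd ((ENNReal.le_ofReal_iff_toReal_le (hω n).ne
        ((ENNReal.toReal_nonneg).trans h1)).2 h1) (not_le.2 hlt)
    rw [zero_add]
    calc P {ω | ∫⁻ x, f x ∂N ω = ∞}
        ≤ P (⋃ n, {ω | ENNReal.ofReal M < Y n ω}) := by
          refine measure_mono fun ω hω ↦ ?_
          have h : ENNReal.ofReal M < ⨆ n, Y n ω := by
            rw [← lintegral_eq_iSup_eapprox hf, show ∫⁻ x, f x ∂N ω = ∞ from hω]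
            exact ENNReal.ofReal_lt_top
          simpa using lt_iSup_iff.1 h
      _ = ⨆ n, P {ω | ENNReal.ofReal M < Y n ω} := by
          refine Monotone.measure_iUnion fun m n hmn ω hω ↦ ?_
          exact lt_of_lt_of_le hω
            (lintegral_mono fun x ↦ SimpleFunc.monotone_eapprox f hmn x)
      _ ≤ ε := iSup_le hbound
  filter_upwards [measure_eq_zero_iff_ae_notMem.1 hzero] with ω hω
  exact lt_top_iff_ne_top.2 hω

/-- The characteristic function of the integral of `f` against a Poisson process. -/
theorem IsPoissonProcess.charFun_lintegral [IsProbabilityMeasure P] (hN : IsPoissonProcess N ρ P)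
    (hf : Measurable f) (hfin : ∀ x, f x < ∞) (hρ : ∫⁻ x, min (f x) 1 ∂ρ < ∞) :
    charFun (P.map fun ω ↦ (∫⁻ x, f x ∂N ω).toReal) =
      fun t ↦ Complex.exp (levyExponent ρ f t) := by
  ext t
  refine tendsto_nhds_unique ?_ (hN.tendsto_charFun_lintegral_eapprox hf hfin hρ t)
  have hm {g : E → ℝ≥0∞} (hg : Measurable g) : Measurable fun ω ↦ (∫⁻ x, g x ∂N ω).toReal :=
    (hN.measurable_lintegral hg).ennreal_toReal
  simp_rw [charFun_apply_real]
  rw [integral_map (hm hf).aemeasurable (by fun_prop)]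
  simp_rw [fun n ↦ integral_map (μ := P)
    (hm (SimpleFunc.measurable (SimpleFunc.eapprox f n))).aemeasurable
    (f := fun x : ℝ ↦ Complex.exp (t * x * Complex.I)) (by fun_prop)]
  refine tendsto_integral_of_dominated_convergence (fun _ ↦ 1)
    (fun n ↦ ?_) (integrable_const 1) (fun n ↦ .of_forall fun ω ↦ ?_) ?_
  · have := hm (SimpleFunc.measurable (SimpleFunc.eapprox f n))
    exact Measurable.aestronglyMeasurable (by fun_prop)
  · rw [← Complex.ofReal_mul, Complex.norm_exp_ofReal_mul_I]
  · filter_upwards [hN.ae_lintegral_lt_top hf hfin hρ] with ω hω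
    have h1 : Tendsto (fun n ↦ ∫⁻ x, SimpleFunc.eapprox f n x ∂N ω) atTop
        (𝓝 (∫⁻ x, f x ∂N ω)) := by
      rw [lintegral_eq_iSup_eapprox hf]
      exact tendsto_atTop_iSup fun m n hmn ↦
        lintegral_mono fun x ↦ SimpleFunc.monotone_eapprox f hmn x
    have hc : Continuous fun y : ℝ ↦ Complex.exp (t * y * Complex.I) := by fun_prop
    exact (hc.tendsto _).comp ((ENNReal.tendsto_toReal hω.ne).comp h1)

end

/-! ### Application to the sum of the points -/

lemma IsLevyMeasure.lintegral_min_lt_top {ρ : Measure (Set.Ioi (0 : ℝ))} (hρ : IsLevyMeasure ρ)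
    (hρ1 : ∫⁻ x in {x : Set.Ioi (0 : ℝ) | (x : ℝ) ≤ 1}, ENNReal.ofReal (x : ℝ) ∂ρ < ∞) :
    ∫⁻ x, min (ENNReal.ofReal (x : ℝ)) 1 ∂ρ < ∞ := by
  have hm : MeasurableSet {x : Set.Ioi (0 : ℝ) | (x : ℝ) ≤ 1} :=
    measurable_subtype_coe measurableSet_Iic
  rw [← lintegral_add_compl _ hm]
  refine ENNReal.add_lt_top.2 ⟨(lintegral_mono fun x ↦ min_le_left _ _).trans_lt hρ1, ?_⟩
  refine (lintegral_mono fun x ↦ min_le_right _ _).trans_lt ?_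
  rw [lintegral_one, Measure.restrict_apply_univ]
  convert hρ.tail_lt_top using 2
  ext x
  simp

lemma lintegral_sumDirac {E : Type*} [MeasurableSpace E] (k : ℕ∞) (u : ℕ → E) {f : E → ℝ≥0∞}
    (hf : Measurable f) :
    ∫⁻ x, f x ∂sumDirac k u = ∑' i : {i : ℕ // (i : ℕ∞) < k}, f (u i) := by
  simp [sumDirac, lintegral_sum_measure, lintegral_dirac' _ hf]

theorem mainTheorem5 {Ω : Type*} [MeasurableSpace Ω] (P : Measure Ω) [IsProbabilityMeasure P]
    (ρ : Measure (Set.Ioi (0 : ℝ))) (hρ : IsLevyMeasure ρ)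
    (hρ1 : ∫⁻ x in {x : Set.Ioi (0 : ℝ) | (x : ℝ) ≤ 1}, ENNReal.ofReal (x : ℝ) ∂ρ < ∞)
    (N : Ω → Measure (Set.Ioi (0 : ℝ))) (hN : IsPoissonProcess N ρ P)
    (K : Ω → ℕ∞) (U : ℕ → Ω → Set.Ioi (0 : ℝ))
    (hNU : ∀ᵐ ω ∂P, N ω = sumDirac (K ω) (fun i => U i ω))
    (X : Ω → ℝ≥0∞) (hX : ∀ ω, X ω = sumPoints (K ω) (fun i => U i ω)) :
    AEMeasurable X P ∧
    (∀ᵐ ω ∂P, X ω < ∞) ∧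
    IsInfinitelyDivisible (P.map (fun ω => (X ω).toReal)) ∧
    ∀ u : ℝ,
      Integrable (fun x : Set.Ioi (0 : ℝ) => Complex.exp (Complex.I * u * (x : ℝ)) - 1) ρ ∧
      ∫ ω, Complex.exp (Complex.I * u * (X ω).toReal) ∂P =
        Complex.exp (∫ x : Set.Ioi (0 : ℝ), (Complex.exp (Complex.I * u * (x : ℝ)) - 1) ∂ρ) := by

  have hf : Measurable fun x : Set.Ioi (0 : ℝ) ↦ ENNReal.ofReal (x : ℝ) := by fun_prop
  have hfin (x : Set.Ioi (0 : ℝ)) : ENNReal.ofReal (x : ℝ) < ∞ := ENNReal.ofReal_lt_top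
  have hmin := hρ.lintegral_min_lt_top hρ1
  have hX' : X =ᵐ[P] fun ω ↦ ∫⁻ x, ENNReal.ofReal (x : ℝ) ∂N ω := by
    filter_upwards [hNU] with ω hω
    rw [hX, hω, lintegral_sumDirac _ _ hf, sumPoints]
  have hXm : AEMeasurable X P := ⟨_, hN.measurable_lintegral hf, hX'⟩
  have hchar : charFun (P.map fun ω ↦ (X ω).toReal) =
      fun t ↦ Complex.exp (levyExponent ρ (fun x ↦ ENNReal.ofReal (x : ℝ)) t) := by
    rw [← hN.charFun_lintegral hf hfin hmin]
    congr 1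
    exact Measure.map_congr (hX'.fun_comp ENNReal.toReal)
  have : IsProbabilityMeasure (P.map fun ω ↦ (X ω).toReal) :=
    Measure.isProbabilityMeasure_map hXm.ennreal_toReal
  have hexp (u : ℝ) (x : Set.Ioi (0 : ℝ)) :
      Complex.exp (u * (ENNReal.ofReal (x : ℝ)).toReal * Complex.I) - 1 =
        Complex.exp (Complex.I * u * (x : ℝ)) - 1 := by
    rw [ENNReal.toReal_ofReal (Set.mem_Ioi.1 x.2).le]
    ring_nf
  refine ⟨hXm, ?_, isInfinitelyDivisible_of_charFun_eq hf hfin hmin hchar, fun u ↦ ⟨?_, ?_⟩⟩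
  · filter_upwards [hX', hN.ae_lintegral_lt_top hf hfin hmin] with ω h1 h2
    exact h1 ▸ h2
  · simpa only [hexp] using integrable_exp_mul_sub_one hf hmin u
  · have h := congrFun hchar u
    rw [charFun_apply_real, integral_map hXm.ennreal_toReal (by fun_prop), levyExponent] at h
    simp_rw [hexp] at h
    rw [← h]
    congr 1 with ω
    ring_nf
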